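/- Let $D$ be a finite digraph without loops and with at most one arc between any two vertices. In the semi-restricted $D$-game with parameter $\mathbf r\in\mathbb Z_{\ge 0}^{V(D)}$, Rei and Norman play $\sum_u \mathbf r_u$ rounds. In each round, both simultaneously and independently pick a vertex, Norman $v$ and Rei $u$, and Norman's score increases by $1$ if $v\to u$ is an arc, decreases by $1$ if $u\to v$ is an arc, and is unchanged otherwise. Rei may only pick $u$ with $\mathbf r_u>0$, and after the round $\mathbf r_u$ is decreased by $1$. A strategy for a player assigns to each nonzero current vector $\mathbf r$ a probability distribution on $V(D)$, for Rei supported in $\operatorname{supp}(\mathbf r)=\{u:\mathbf r_u>0\}$. Let $S_D(\mathbf r;\mathcal N,\mathcal R)$ be the expected final score of Norman when Norman and Rei use the strategies $\mathcal N$ and $\mathcal R$, and put $S_D(\mathbf r;\mathcal R)=\max_{\mathcal N}S_D(\mathbf r;\mathcal N,\mathcal R)$ and $S_D(\mathbf r)=\min_{\mathcal R}S_D(\mathbf r;\mathcal R)$. A strategy $\mathcal R$ for Rei is optimal if $S_D(\mathbf r;\mathcal R)=S_D(\mathbf r)$ for all $\mathbf r$, and it is oblivious if the distribution $\mathcal R(\mathbf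 r)$ depends only on $\operatorname{supp}(\mathbf r)$. The digraph $D$ is called oblivious if Rei has an optimal strategy that is oblivious. Theorem. Let $\mathcal T_n$ denote the set of tournaments on $[n]=\{1,\dots,n\}$. There exists a constant $c>0$ such that if $n$ is sufficiently large and $D$ is chosen uniformly at random from $\mathcal T_n$, then \[\Pr(D\text{ is oblivious})\le e^{-cn}.\] -/

import Mathlib

namespace SemiRestricted

/-- A tournament: no loops, and exactly one of the two possible arcs between any two distinct
vertices. -/
def IsTournament {V : Type*} (D : Digraph V) : Prop :=
  (∀ v, ¬ D.Adj v v) ∧ ∀ u v, u ≠ v → (D.Adj u v ↔ ¬ D.Adj v u)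

/-- The set of tournaments on `n` labelled vertices. -/
def tournaments (n : ℕ) : Set (Digraph (Fin n)) :=
  {D | IsTournament D}

open Classical in
/-- The change of Norman's score when Norman plays `v` and Rei plays `u`. -/
noncomputable def payoff {V : Type*} (D : Digraph V) (v u : V) : ℤ :=
  if D.Adj v u then 1 else if D.Adj u v then -1 else 0

/-- A strategy for Norman: for each restriction vector at which a round is still to be played
(that is, each nonzero one), the law of his move. -/
def NormanStrategy (V : Type*) : Type _ :=
  ∀ r : V → ℕ, r ≠ 0 → PMF V

/-- A strategy for Rei: for each restriction vector at which a round is still to be played,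
the law of her move, which only charges options that are still available. -/
structure ReiStrategy (V : Type*) where
  move : ∀ r : V → ℕ, r ≠ 0 → PMF V
  support_move : ∀ (r : V → ℕ) (h : r ≠ 0), (move r h).support ⊆ Function.support r

section Game

variable {V : Type*} [Fintype V] [DecidableEq V]

/-- Using an available option lowers the number of remaining rounds. -/
theorem sum_sub_single_lt (r : V → ℕ) (u : V) (hu : r u ≠ 0) :
    ∑ w, (r - Pi.single u 1 : V → ℕ) w < ∑ w, r w := by
  refine Finset.sum_lt_sum (fun w _ => Nat.sub_le _ _) ⟨u, Finset.mem_univ u, ?_⟩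
  simp only [Pi.sub_apply, Pi.single_eq_same]
  omega

/-- The law of the score (for Norman) of the semi-restricted `D`-game with parameter `r`.
In each round Norman's move `v` and Rei's move `u` are drawn independently (of each other and of
the past) according to their strategies, and one copy of `u` is then removed from `r`; the game
ends when `r = 0`. -/
noncomputable def score (D : Digraph V) (N : NormanStrategy V) (R : ReiStrategy V)
    (r : V → ℕ) : PMF ℤ :=
  open Classical in
  if h : r = 0 then PMF.pure 0
  else (N r h).bind fun v => (R.move r h).bindOnSupport fun u _ =>
    (score D N R (r - Pi.single u 1)).map fun s => payoff D v u + s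
termination_by ∑ w, r w
decreasing_by
  exact sum_sub_single_lt r u (R.support_move r h ‹_›)

/-- The expected score for Norman under the given pair of strategies. -/
noncomputable def expectedScore (D : Digraph V) (N : NormanStrategy V) (R : ReiStrategy V)
    (r : V → ℕ) : ℝ :=
  ∫ s, (s : ℝ) ∂(score D N R r).toMeasure

/-- The expected score when Norman plays optimally against Rei's strategy `R`. -/
noncomputable def scoreAgainst (D : Digraph V) (R : ReiStrategy V) (r : V → ℕ) : ℝ :=
  ⨆ N : NormanStrategy V, expectedScore D N R r

/-- The expected score when both players play optimally. -/
noncomputable def value (D : Digraph V) (r : V → ℕ) : ℝ :=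
  ⨅ R : ReiStrategy V, scoreAgainst D R r

/-- `R` is optimal for Rei: it attains the value at every restriction vector. -/
def ReiStrategy.IsOptimal (D : Digraph V) (R : ReiStrategy V) : Prop :=
  ∀ r : V → ℕ, scoreAgainst D R r = value D r

end Game

/-- `R` is oblivious: the law of Rei's move depends only on the support of the restriction
vector. -/
def ReiStrategy.IsOblivious {V : Type*} (R : ReiStrategy V) : Prop :=
  ∀ (r r' : V → ℕ) (h : r ≠ 0) (h' : r' ≠ 0),
    Function.support r = Function.support r' → R.move r h = R.move r' h'

/-- `D` is oblivious: Rei has an optimal strategy which is oblivious. -/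
def IsObliviousDigraph {V : Type*} [Fintype V] [DecidableEq V] (D : Digraph V) : Prop :=
  ∃ R : ReiStrategy V, R.IsOptimal D ∧ R.IsOblivious

/-- The probability that a uniformly random tournament on `n` labelled vertices is oblivious. -/
noncomputable def probOblivious (n : ℕ) : ℝ :=
  ({D ∈ tournaments n | IsObliviousDigraph D}.ncard : ℝ) / ((tournaments n).ncard : ℝ)

end SemiRestricted

namespace SemiRestricted

/-! ### Expected scores and the one-round recursion. -/

section Game

variable {V : Type*} [Fintype V] [DecidableEq V]

/-! An oblivious strategy uses one fixed law `p` as long as every option is available. Suppose that,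
for some `r` with full support, constant play of `v` is strictly the best constant play for Norman.
In the game `t • r`, drawing uniformly from the remaining copies costs Rei only `rowSum D v (t • r)
+ O(log t)`: the proportions form a martingale, and a quadratic potential bounds what Norman can
gain by deviating from `v`. If `p` instead gave some `w` an advantage `δ > 0` over `v`, Norman could
play `w` until an option runs out and `v` afterwards, gaining at least `t * δ`. Hence optimality
makes `v` a best reply to `p`.

If no out-neighbourhood is contained in another one, every `v` is the strict best for a suitable
`r`. All pure replies to `p` then score the same, and skew-symmetry forces this common score to be
zero, so `p` is a nonnegative kernel vector of the payoff matrix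
(`hasNonnegKernel_of_isObliviousDigraph`).

Both ways out are exponentially rare. Modulo 2 a tournament matrix is `J - I`, invertible in even
order; so a nonzero kernel vector has no zero coordinate and is unique up to scale. Among the `2 ^
n` reversals across a bipartition, which only flip signs of kernel coordinates, at most two give a
nonnegative kernel vector. Containment of out-neighbourhoods has probability at most `16 / 9 * (3 /
4) ^ n` for each ordered pair. A union bound finishes. -/

theorem integral_pmf_of_finite_support {p : PMF ℤ} (hp : p.support.Finite) (f : ℤ → ℝ) :
    MeasureTheory.Integrable f p.toMeasure ∧
      ∫ s, f s ∂p.toMeasure = ∑ s ∈ hp.toFinset, (p s).toReal * f s := by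
  have hint : MeasureTheory.Integrable f p.toMeasure := by
    have h1 : p.toMeasure p.supportᶜ = 0 := by
      rw [PMF.toMeasure_apply_eq_zero_iff _ (MeasurableSet.of_discrete)]
      exact disjoint_compl_right
    have h2 : MeasureTheory.IntegrableOn f p.support p.toMeasure :=
      MeasureTheory.IntegrableOn.of_finite hp
    have h3 : p.toMeasure.restrict p.support = p.toMeasure :=
      MeasureTheory.Measure.restrict_eq_self_of_ae_mem (MeasureTheory.mem_ae_iff.2 h1)
    rwa [MeasureTheory.IntegrableOn, h3] at h2
  refine ⟨hint, ?_⟩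
  rw [PMF.integral_eq_tsum _ _ hint, tsum_eq_sum (s := hp.toFinset)]
  · simp
  · intro b hb
    have : p b = 0 := (PMF.apply_eq_zero_iff _ _).2 fun h => hb (hp.mem_toFinset.2 h)
    simp [this]

theorem integral_pmf_bind {α : Type*} [Fintype α] (p : PMF α) (f : α → PMF ℤ)
    (hf : ∀ a, (f a).support.Finite) (g : ℤ → ℝ) :
    ∫ s, g s ∂(p.bind f).toMeasure = ∑ a, (p a).toReal * ∫ s, g s ∂(f a).toMeasure := by
  have hb : (p.bind f).support.Finite := by
    rw [PMF.support_bind]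
    exact (Set.toFinite p.support).biUnion fun a _ => hf a
  set S : Finset ℤ := hb.toFinset ∪ Finset.univ.biUnion fun a => (hf a).toFinset with hS
  have key : ∀ (q : PMF ℤ) (hq : q.support.Finite), hq.toFinset ⊆ S →
      ∫ s, g s ∂q.toMeasure = ∑ s ∈ S, (q s).toReal * g s := by
    intro q hq hsub
    rw [(integral_pmf_of_finite_support hq g).2]
    refine Finset.sum_subset hsub fun x _ hx => ?_
    have : q x = 0 := (PMF.apply_eq_zero_iff _ _).2 fun h => hx (hq.mem_toFinset.2 h)
    simp [this]
  rw [key _ hb Finset.subset_union_left]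
  have h2 : ∀ a, ∫ s, g s ∂(f a).toMeasure = ∑ s ∈ S, (f a s).toReal * g s := fun a =>
    key _ (hf a) ((Finset.subset_biUnion_of_mem (fun a => (hf a).toFinset)
      (Finset.mem_univ a)).trans Finset.subset_union_right)
  simp_rw [h2, Finset.mul_sum]
  rw [Finset.sum_comm]
  refine Finset.sum_congr rfl fun s _ => ?_
  rw [PMF.bind_apply, tsum_fintype, ENNReal.toReal_sum, Finset.sum_mul]
  · exact Finset.sum_congr rfl fun a _ => by rw [ENNReal.toReal_mul]; ring
  · exact fun a _ => ENNReal.mul_ne_top (PMF.apply_ne_top _ _) (PMF.apply_ne_top _ _)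

theorem pmf_sum_toReal {α : Type*} [Fintype α] (p : PMF α) : ∑ a, (p a).toReal = 1 := by
  rw [← ENNReal.toReal_sum fun a _ => PMF.apply_ne_top _ _, ← tsum_fintype (L := .unconditional _), p.tsum_coe,
    ENNReal.toReal_one]

variable (D : Digraph V) (N : NormanStrategy V) (R : ReiStrategy V)

theorem score_zero : score D N R 0 = PMF.pure 0 := by
  rw [score]; simp

theorem score_of_ne_zero {r : V → ℕ} (h : r ≠ 0) :
    score D N R r = (N r h).bind fun v => (R.move r h).bind fun u =>
      (score D N R (r - Pi.single u 1)).map fun s => payoff D v u + s := by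
  rw [score]; simp [h, PMF.bindOnSupport_eq_bind]

/-- Induction over restriction vectors by playing a single round. -/
theorem round_induction {P : (V → ℕ) → Prop} (h0 : P 0)
    (h : ∀ r, r ≠ 0 → (∀ u, r u ≠ 0 → P (r - Pi.single u 1)) → P r) (r : V → ℕ) : P r := by
  induction hk : ∑ w, r w using Nat.strong_induction_on generalizing r with
  | _ k ih =>
    by_cases hr : r = 0
    · exact hr ▸ h0
    · exact h r hr fun u hu => ih _ (hk ▸ sum_sub_single_lt r u hu) _ rfl

theorem support_score_finite (r : V → ℕ) : (score D N R r).support.Finite := by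
  induction r using round_induction with
  | h0 => rw [score_zero, PMF.support_pure]; exact Set.finite_singleton _
  | h r hr ih =>
    rw [score_of_ne_zero D N R hr, PMF.support_bind]
    refine (Set.toFinite _).biUnion fun v _ => ?_
    rw [PMF.support_bind]
    refine (Set.toFinite _).biUnion fun u hu => ?_
    rw [PMF.support_map]
    exact (ih u (R.support_move r hr hu)).image _

theorem expectedScore_zero : expectedScore D N R 0 = 0 := by
  rw [expectedScore, (integral_pmf_of_finite_support (support_score_finite D N R 0) _).2]
  refine Finset.sum_eq_zero fun s hs => ?_
  have : s = 0 := by simpa [score_zero] using hs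
  simp [this]

theorem expectedScore_of_ne_zero {r : V → ℕ} (h : r ≠ 0) :
    expectedScore D N R r = ∑ v, (N r h v).toReal * ∑ u, (R.move r h u).toReal *
      (payoff D v u + expectedScore D N R (r - Pi.single u 1)) := by
  have hm : ∀ v u, ((score D N R (r - Pi.single u 1)).map
      fun s => payoff D v u + s).support.Finite := fun v u => by
    rw [PMF.support_map]
    exact (support_score_finite D N R _).image _
  have hb : ∀ v, ((R.move r h).bind fun u =>
      (score D N R (r - Pi.single u 1)).map fun s => payoff D v u + s).support.Finite := fun v => by
    rw [PMF.support_bind]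
    exact (Set.toFinite _).biUnion fun u _ => hm v u
  rw [expectedScore, score_of_ne_zero D N R h, integral_pmf_bind _ _ hb]
  refine Finset.sum_congr rfl fun v _ => ?_
  rw [integral_pmf_bind _ _ (hm v)]
  congr 1
  refine Finset.sum_congr rfl fun u _ => ?_
  congr 1
  have hfin := integral_pmf_of_finite_support (support_score_finite D N R (r - Pi.single u 1))
    fun s => (s : ℝ)
  rw [← PMF.toMeasure_map _ _ (measurable_of_countable _),
    MeasureTheory.integral_map (measurable_of_countable _).aemeasurable
      (measurable_of_countable _).aestronglyMeasurable]
  push_cast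
  rw [MeasureTheory.integral_add (MeasureTheory.integrable_const _) hfin.1]
  simp [expectedScore]

theorem expectedScore_le_of_step {r : V → ℕ} (h : r ≠ 0) {g : V → ℝ}
    (hg : ∀ u, r u ≠ 0 → expectedScore D N R (r - Pi.single u 1) ≤ g u) :
    expectedScore D N R r ≤ ∑ v, (N r h v).toReal * ∑ u, (R.move r h u).toReal *
      (payoff D v u + g u) := by
  rw [expectedScore_of_ne_zero D N R h]
  refine Finset.sum_le_sum fun v _ => mul_le_mul_of_nonneg_left
    (Finset.sum_le_sum fun u _ => ?_) ENNReal.toReal_nonneg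
  by_cases hu : r u = 0
  · have : R.move r h u = 0 := by
      by_contra hne
      exact R.support_move r h ((PMF.mem_support_iff _ _).2 hne) hu
    simp [this]
  · have := hg u hu
    gcongr

theorem le_expectedScore_of_step {r : V → ℕ} (h : r ≠ 0) {g : V → ℝ}
    (hg : ∀ u, r u ≠ 0 → g u ≤ expectedScore D N R (r - Pi.single u 1)) :
    ∑ v, (N r h v).toReal * ∑ u, (R.move r h u).toReal * (payoff D v u + g u) ≤
      expectedScore D N R r := by
  rw [expectedScore_of_ne_zero D N R h]
  refine Finset.sum_le_sum fun v _ => mul_le_mul_of_nonneg_left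
    (Finset.sum_le_sum fun u _ => ?_) ENNReal.toReal_nonneg
  by_cases hu : r u = 0
  · have : R.move r h u = 0 := by
      by_contra hne
      exact R.support_move r h ((PMF.mem_support_iff _ _).2 hne) hu
    simp [this]
  · have := hg u hu
    gcongr

theorem sum_sub_single_add_one {r : V → ℕ} {u : V} (hu : r u ≠ 0) (f : V → ℝ) :
    ∑ w, ((r - Pi.single u 1 : V → ℕ) w : ℝ) * f w = (∑ w, (r w : ℝ) * f w) - f u := by
  have : ∀ w, ((r - Pi.single u 1 : V → ℕ) w : ℝ) * f w =
      (r w : ℝ) * f w - if w = u then f u else 0 := by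
    intro w
    by_cases hw : w = u
    · subst hw
      have : 1 ≤ r w := Nat.one_le_iff_ne_zero.2 hu
      simp [Nat.cast_sub this]
      ring
    · simp [hw]
  simp_rw [this, Finset.sum_sub_distrib]
  simp

/-! ### Elementary bounds and Norman's pure and switching strategies. -/

theorem abs_payoff_le {V : Type*} (D : Digraph V) (v u : V) : |(payoff D v u : ℝ)| ≤ 1 := by
  unfold payoff
  split_ifs <;> simp

theorem expectedScore_le_sum (r : V → ℕ) : expectedScore D N R r ≤ ∑ w, (r w : ℝ) := by
  induction r using round_induction with
  | h0 => simp [expectedScore_zero]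
  | h r hr ih =>
    refine (expectedScore_le_of_step D N R hr (g := fun _ => (∑ w, (r w : ℝ)) - 1)
      fun u hu => ?_).trans ?_
    · have := sum_sub_single_add_one hu fun _ => 1
      simp only [mul_one] at this
      exact this ▸ ih u hu
    · calc _ ≤ ∑ v, (N r hr v).toReal * ∑ u, (R.move r hr u).toReal * ∑ w, (r w : ℝ) := by
            gcongr with v _ u _
            have := (abs_le.1 (abs_payoff_le D v u)).2
            linarith
        _ = _ := by rw [← Finset.sum_mul, ← Finset.sum_mul, pmf_sum_toReal, pmf_sum_toReal]; ring

/-- Makes the supremum in `scoreAgainst` genuine: an unbounded real supremum would be `0` by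
default. -/
theorem bddAbove_range_expectedScore (r : V → ℕ) :
    BddAbove (Set.range fun N : NormanStrategy V => expectedScore D N R r) :=
  ⟨∑ w, (r w : ℝ), by rintro _ ⟨N, rfl⟩; exact expectedScore_le_sum D N R r⟩

/-- The score of Norman when he always plays `v`. -/
noncomputable def rowSum (D : Digraph V) (v : V) (r : V → ℕ) : ℝ :=
  ∑ u, (r u : ℝ) * (payoff D v u : ℝ)

/-- Norman plays `w` while all options are available to Rei, and `v` afterwards. -/
noncomputable def switchStrategy (v w : V) : NormanStrategy V :=
  fun r _ => PMF.pure (if ∀ u, r u ≠ 0 then w else v)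

omit [DecidableEq V] in
theorem sum_pure_toReal_mul (v : V) (f : V → ℝ) :
    ∑ w, (PMF.pure v w).toReal * f w = f v := by
  rw [Finset.sum_eq_single v]
  · simp
  · intro b _ hb
    simp [PMF.pure_apply, hb]
  · simp

theorem rowSum_sub_single (D : Digraph V) (v : V) {r : V → ℕ} {u : V} (hu : r u ≠ 0) :
    rowSum D v (r - Pi.single u 1) = rowSum D v r - payoff D v u :=
  sum_sub_single_add_one hu _

/-- As long as every option is available, `w` earns `δ` more than `v` per round in expectation. A
round removes one copy of one option, so at least `m` rounds are of this kind; from then on constant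
`v` collects exactly the remaining row sum. -/
theorem rowSum_add_le_expectedScore (D : Digraph V) (R : ReiStrategy V) {p : V → ℝ}
    (hp : ∀ r (h : r ≠ 0), (∀ u, r u ≠ 0) → ∀ u, (R.move r h u).toReal = p u) (v w : V)
    (hδ : 0 ≤ ∑ u, p u * (payoff D w u - payoff D v u : ℝ)) (r : V → ℕ) (m : ℕ)
    (hm : ∀ u, m ≤ r u) :
    rowSum D v r + m * ∑ u, p u * (payoff D w u - payoff D v u : ℝ) ≤
      expectedScore D (switchStrategy v w) R r := by
  set δ := ∑ u, p u * (payoff D w u - payoff D v u : ℝ) with hδdef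
  induction r using round_induction generalizing m with
  | h0 =>
    have : m = 0 := by simpa using hm v
    simp [expectedScore_zero, rowSum, this]
  | h r hr ih =>
    refine le_trans ?_ (le_expectedScore_of_step D (switchStrategy v w) R hr
      (g := fun u => rowSum D v r - payoff D v u + (m - 1 : ℕ) * δ) fun u hu => ?_)
    · rw [switchStrategy, sum_pure_toReal_mul]
      have h1 := pmf_sum_toReal (R.move r hr)
      by_cases hf : ∀ u, r u ≠ 0
      · have hp' := hp r hr hf
        simp only [hp'] at h1 ⊢
        rw [if_pos hf]
        have h2 : ∑ u, p u * ((payoff D w u : ℝ) +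
            (rowSum D v r - payoff D v u + (m - 1 : ℕ) * δ)) =
            δ + (rowSum D v r + (m - 1 : ℕ) * δ) := by
          rw [← one_mul (rowSum D v r + (m - 1 : ℕ) * δ), ← h1, hδdef, Finset.sum_mul,
            ← Finset.sum_add_distrib]
          exact Finset.sum_congr rfl fun u _ => by ring
        rw [h2]
        have h3 : (m : ℝ) ≤ (m - 1 : ℕ) + 1 := by
          exact_mod_cast Nat.le_add_of_sub_le le_rfl
        nlinarith
      -- An exhausted option forces `m = 0`, and the truncated `0 - 1` is again `0`, so no bonus is
      -- left to account for.
      · rw [if_neg hf]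
        have hm0 : m = 0 := by
          push Not at hf
          obtain ⟨u, hu⟩ := hf
          simpa [hu] using hm u
        subst hm0
        have h2 : ∑ u, (R.move r hr u).toReal * ((payoff D v u : ℝ) +
            (rowSum D v r - payoff D v u + (0 - 1 : ℕ) * δ)) = rowSum D v r := by
          calc _ = ∑ u, (R.move r hr u).toReal * rowSum D v r :=
                Finset.sum_congr rfl fun u _ => by push_cast; ring
            _ = _ := by rw [← Finset.sum_mul, h1, one_mul]
        rw [h2]
        simp
    · rw [← rowSum_sub_single D v hu]
      refine ih u hu (m - 1) fun x => ?_
      have := hm x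
      have h5 : (Pi.single u 1 : V → ℕ) x ≤ 1 := by
        by_cases hx : x = u
        · subst hx; simp
        · simp [hx]
      simp only [Pi.sub_apply]
      omega

/-- Rei must use up all of `r`, so constant `v` scores the row sum whatever she does. This also
bounds the infimum in `value` from below. -/
theorem rowSum_le_scoreAgainst (D : Digraph V) (R : ReiStrategy V) (v : V) (r : V → ℕ) :
    rowSum D v r ≤ scoreAgainst D R r := by
  refine le_trans ?_ (le_ciSup (bddAbove_range_expectedScore D R r) (switchStrategy v v))
  induction r using round_induction with
  | h0 => simp [expectedScore_zero, rowSum]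
  | h r hr ih =>
    refine le_trans (le_of_eq ?_) (le_expectedScore_of_step D (switchStrategy v v) R hr
      (g := fun u => rowSum D v r - payoff D v u) fun u hu => ?_)
    · rw [switchStrategy, sum_pure_toReal_mul, ite_self]
      simp only [add_sub_cancel]
      rw [← Finset.sum_mul, pmf_sum_toReal, one_mul]
    · rw [← rowSum_sub_single D v hu]
      exact ih u hu

theorem value_le_scoreAgainst [Nonempty V] (D : Digraph V) (R : ReiStrategy V) (r : V → ℕ) :
    value D r ≤ scoreAgainst D R r :=
  ciInf_le ⟨rowSum D (Classical.arbitrary V) r, by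
    rintro _ ⟨R, rfl⟩; exact rowSum_le_scoreAgainst D R _ r⟩ R

/-! ### The proportional strategy loses only logarithmically. -/

omit [DecidableEq V] in
theorem total_ne_zero {r : V → ℕ} (h : r ≠ 0) : ∑ u, r u ≠ 0 := fun h0 => h <| by
  ext u
  exact Finset.sum_eq_zero_iff.1 h0 u (Finset.mem_univ u)

/-- Rei picks a uniformly random one of the remaining copies. -/
noncomputable def proportionalStrategy (V : Type*) [Fintype V] [DecidableEq V] :
    ReiStrategy V where
  move r h := PMF.ofFintype (fun u => (r u : ENNReal) / ((∑ w, r w : ℕ) : ENNReal)) <| by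
    simp only [div_eq_mul_inv]
    rw [← Finset.sum_mul, ← Nat.cast_sum]
    exact ENNReal.mul_inv_cancel (by exact_mod_cast total_ne_zero h) (ENNReal.natCast_ne_top _)
  support_move r h u hu hr := by
    rw [PMF.mem_support_iff, PMF.ofFintype_apply] at hu
    simp [hr] at hu

theorem proportionalStrategy_move (r : V → ℕ) (h : r ≠ 0) (u : V) :
    ((proportionalStrategy V).move r h u).toReal = (r u : ℝ) / ((∑ w, r w : ℕ) : ℝ) := by
  rw [proportionalStrategy, PMF.ofFintype_apply, ENNReal.toReal_div, ENNReal.toReal_natCast,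
    ENNReal.toReal_natCast]

omit [DecidableEq V] in
-- Under proportional draws `Z / K` is a martingale with increments of order `1 / K`. The potential
-- `Z ^ 2 / K + 2 * B * harmonic K` therefore pays for the cost `(Z / K) ^ 2` of the round and the
-- expected potential of the next state.
theorem quadratic_step {r : V → ℕ} (hr : r ≠ 0) (z : V → ℝ) {B : ℝ} (hz : ∀ u, z u ^ 2 ≤ B) :
    ((∑ u, (r u : ℝ) * z u) / ((∑ w, r w : ℕ) : ℝ)) ^ 2 +
      ∑ u, (r u : ℝ) / ((∑ w, r w : ℕ) : ℝ) *
        (((∑ u, (r u : ℝ) * z u) - z u) ^ 2 / ((∑ w, r w : ℕ) - 1 : ℝ) +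
          2 * B * harmonic ((∑ w, r w) - 1)) ≤
    (∑ u, (r u : ℝ) * z u) ^ 2 / ((∑ w, r w : ℕ) : ℝ) + 2 * B * harmonic (∑ w, r w) := by
  set Z := ∑ u, (r u : ℝ) * z u with hZ
  have hK0 := total_ne_zero hr
  have hcast : ((∑ w, r w : ℕ) : ℝ) = ∑ w, (r w : ℝ) := by push_cast; rfl
  set K := ∑ w, r w with hK
  have hB : 0 ≤ B := by
    obtain ⟨u, _⟩ := Function.ne_iff.1 hr
    exact (sq_nonneg _).trans (hz u)
  obtain ⟨k, hk⟩ := Nat.exists_eq_succ_of_ne_zero hK0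
  have hKpos : (0 : ℝ) < K := by exact_mod_cast Nat.pos_of_ne_zero hK0
  have hone : ∑ u, (r u : ℝ) / K = 1 := by
    rw [← Finset.sum_div, ← hcast, div_self hKpos.ne']
  have hH : (harmonic K : ℝ) = harmonic (K - 1) + 1 / (K : ℝ) := by
    rw [hk, harmonic_succ]; push_cast; simp
  have hsq : ∑ u, (r u : ℝ) / K * (Z - z u) ^ 2 ≤ Z ^ 2 - 2 * Z ^ 2 / K + B := by
    calc _ ≤ ∑ u, ((r u : ℝ) / K * (Z ^ 2 + B) - 2 * Z / K * ((r u : ℝ) * z u)) := by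
          refine Finset.sum_le_sum fun u _ => ?_
          have : (r u : ℝ) / K * (z u) ^ 2 ≤ (r u : ℝ) / K * B :=
            mul_le_mul_of_nonneg_left (hz u) (by positivity)
          have e : 2 * Z / K * ((r u : ℝ) * z u) = (r u : ℝ) / K * (2 * Z * z u) := by ring
          rw [e]
          nlinarith
      _ = _ := by
          rw [Finset.sum_sub_distrib, ← Finset.sum_mul, ← Finset.mul_sum, hone, ← hZ]
          ring
  have hsplit : ∑ u, (r u : ℝ) / K * ((Z - z u) ^ 2 / (K - 1 : ℝ) + 2 * B * harmonic (K - 1)) =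
      (∑ u, (r u : ℝ) / K * (Z - z u) ^ 2) / (K - 1 : ℝ) + 2 * B * harmonic (K - 1) := by
    simp only [mul_add, Finset.sum_add_distrib]
    rw [← Finset.sum_mul, hone, one_mul, Finset.sum_div]
    congr 1
    exact Finset.sum_congr rfl fun u _ => by ring
  rw [hsplit, hH]
  suffices h : (Z / K) ^ 2 + (∑ u, (r u : ℝ) / K * (Z - z u) ^ 2) / (K - 1 : ℝ) ≤
      Z ^ 2 / K + 2 * B / K by
    have : 2 * B * ((harmonic (K - 1) : ℝ) + 1 / K) = 2 * B * harmonic (K - 1) + 2 * B / K := by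
      ring
    linarith
  -- In the last round `K - 1 = 0`, and the quotient by it is `0` by convention.
  rcases Nat.eq_zero_or_pos k with hk0 | hkpos
  · have : (K : ℝ) = 1 := by rw [hk, hk0]; simp
    rw [this]
    simp
    positivity
  · have hK1 : (2 : ℝ) ≤ K := by rw [hk]; exact_mod_cast Nat.succ_le_succ hkpos
    have hK1' : (0 : ℝ) < K - 1 := by linarith
    calc _ ≤ (Z / K) ^ 2 + (Z ^ 2 - 2 * Z ^ 2 / K + B) / (K - 1 : ℝ) := by gcongr
      _ ≤ _ := by
        rw [← sub_nonneg]
        have : Z ^ 2 / K + 2 * B / K - ((Z / K) ^ 2 + (Z ^ 2 - 2 * Z ^ 2 / K + B) / (K - 1 : ℝ)) =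
            (Z ^ 2 + B * K * (K - 2)) / (K ^ 2 * (K - 1)) := by
          field_simp
          ring
        rw [this]
        have : 0 ≤ (K : ℝ) - 2 := by linarith
        positivity

/-- The parabola touches the line `y` at `y = γ` and vanishes at `y = -γ`, so it replaces the
positive part by something `quadratic_step` can handle. -/
theorem posPart_le_quadratic {y γ : ℝ} (hγ : 0 < γ) : max y 0 ≤ (y + γ) ^ 2 / (4 * γ) := by
  rw [le_div_iff₀ (by positivity)]
  rcases max_cases y 0 with ⟨h, _⟩ | ⟨h, _⟩ <;> rw [h] <;> nlinarith [sq_nonneg (y - γ)]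

/-- Excess of the score of `w` over that of `v`, shifted by `γ` in each round. -/
noncomputable def excess (D : Digraph V) (v w : V) (γ : ℝ) (u : V) : ℝ :=
  payoff D w u - payoff D v u + γ

omit [DecidableEq V] in
theorem sum_mul_excess (D : Digraph V) (v w : V) (γ : ℝ) (r : V → ℕ) :
    ∑ u, (r u : ℝ) * excess D v w γ u =
      rowSum D w r - rowSum D v r + ((∑ u, r u : ℕ) : ℝ) * γ := by
  simp only [excess, rowSum, mul_add, mul_sub, Finset.sum_add_distrib, Finset.sum_sub_distrib]
  rw [← Finset.sum_mul]
  push_cast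
  rfl

omit [Fintype V] [DecidableEq V] in
theorem excess_sq_le (D : Digraph V) (v w : V) {γ : ℝ} (h0 : 0 ≤ γ) (u : V) :
    excess D v w γ u ^ 2 ≤ (2 + γ) ^ 2 := by
  have h1 := abs_le.1 (abs_payoff_le D w u)
  have h2 := abs_le.1 (abs_payoff_le D v u)
  unfold excess
  exact sq_le_sq' (by linarith [h1.1, h2.2]) (by linarith [h1.2, h2.1])

/-- Bound for the expected gain of Norman, over always playing `v`, against the proportional
strategy. -/
noncomputable def gainBound (D : Digraph V) (v : V) (γ : V → ℝ) (r : V → ℕ) : ℝ :=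
  ∑ w ∈ Finset.univ.erase v, ((∑ u, (r u : ℝ) * excess D v w (γ w) u) ^ 2 /
    ((∑ u, r u : ℕ) : ℝ) + 2 * (2 + γ w) ^ 2 * harmonic (∑ u, r u)) / (4 * γ w)

/-- In one round `v'` gains `(rowSum D v' r - rowSum D v r) / K` over `v`. The quadratic bound turns
this into the squared mean excess of `v'`, and summing over all `w ≠ v` covers every choice of `v'`.
`quadratic_step` then propagates each summand. -/
theorem expectedScore_proportionalStrategy_le (D : Digraph V) (N : NormanStrategy V) (v : V)
    {γ : V → ℝ} (hγ : ∀ w, w ≠ v → 0 < γ w) (r : V → ℕ) :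
    expectedScore D N (proportionalStrategy V) r ≤ rowSum D v r + gainBound D v γ r := by
  induction r using round_induction with
  | h0 => simp [expectedScore_zero, rowSum, gainBound]
  | h r hr ih =>
    have hK0 := total_ne_zero hr
    set K := ∑ u, r u with hK
    have hKpos : (0 : ℝ) < K := by exact_mod_cast Nat.pos_of_ne_zero hK0
    have hone : ∑ u, (r u : ℝ) / K = 1 := by
      rw [← Finset.sum_div, hK]; push_cast; exact div_self (by exact_mod_cast hK0)
    have hchild : ∀ u, r u ≠ 0 → ∑ w, (r - Pi.single u 1 : V → ℕ) w = K - 1 := by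
      intro u hu
      have h1 := sum_sub_single_add_one hu fun _ => 1
      simp only [mul_one] at h1
      have h2 : ((∑ w, (r - Pi.single u 1 : V → ℕ) w : ℕ) : ℝ) + 1 = (K : ℕ) := by
        push_cast [hK]; rw [h1]; ring
      have h3 : (∑ w, (r - Pi.single u 1 : V → ℕ) w) + 1 = K := by exact_mod_cast h2
      omega
    refine (expectedScore_le_of_step D N _ hr (g := fun u => rowSum D v r - payoff D v u +
      ∑ w ∈ Finset.univ.erase v, (((∑ x, (r x : ℝ) * excess D v w (γ w) x) -
        excess D v w (γ w) u) ^ 2 / (K - 1 : ℝ) +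
        2 * (2 + γ w) ^ 2 * harmonic (K - 1)) / (4 * γ w)) fun u hu => ?_).trans ?_
    · refine (ih u hu).trans (le_of_eq ?_)
      rw [rowSum_sub_single D v hu, gainBound, hchild u hu]
      congr 1
      refine Finset.sum_congr rfl fun w _ => ?_
      rw [sum_sub_single_add_one hu, Nat.cast_sub (Nat.one_le_iff_ne_zero.2 hK0)]
      simp
    · simp only [proportionalStrategy_move]
      rw [← hK]
      have hv' : ∀ v', ∑ u, (r u : ℝ) / K * ((payoff D v' u : ℝ) + (rowSum D v r - payoff D v u +
          ∑ w ∈ Finset.univ.erase v, (((∑ x, (r x : ℝ) * excess D v w (γ w) x) -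
            excess D v w (γ w) u) ^ 2 / (K - 1 : ℝ) +
            2 * (2 + γ w) ^ 2 * harmonic (K - 1)) / (4 * γ w))) ≤
          rowSum D v r + gainBound D v γ r := by
        intro v'
        have e1 : ∑ u, (r u : ℝ) / K * ((payoff D v' u : ℝ) + (rowSum D v r - payoff D v u +
            ∑ w ∈ Finset.univ.erase v, (((∑ x, (r x : ℝ) * excess D v w (γ w) x) -
            excess D v w (γ w) u) ^ 2 / (K - 1 : ℝ) +
            2 * (2 + γ w) ^ 2 * harmonic (K - 1)) / (4 * γ w))) =
            rowSum D v r + ((rowSum D v' r - rowSum D v r) / K +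
            ∑ w ∈ Finset.univ.erase v, (∑ u, (r u : ℝ) / K *
            (((∑ x, (r x : ℝ) * excess D v w (γ w) x) -
            excess D v w (γ w) u) ^ 2 / (K - 1 : ℝ) +
            2 * (2 + γ w) ^ 2 * harmonic (K - 1))) / (4 * γ w)) := by
          simp only [mul_add, mul_sub, Finset.sum_add_distrib, Finset.sum_sub_distrib]
          rw [← Finset.sum_mul, hone, one_mul]
          have a1 : ∀ x, ∑ u, (r u : ℝ) / K * (payoff D x u : ℝ) = rowSum D x r / K := by
            intro x
            rw [rowSum, Finset.sum_div]
            exact Finset.sum_congr rfl fun u _ => by ring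
          rw [a1, a1]
          have a2 : ∀ f : V → V → ℝ, ∑ u, (r u : ℝ) / K *
              (∑ w ∈ Finset.univ.erase v, f w u / (4 * γ w)) =
              ∑ w ∈ Finset.univ.erase v, (∑ u, (r u : ℝ) / K * f w u) / (4 * γ w) := by
            intro f
            simp_rw [Finset.mul_sum, Finset.sum_div]
            rw [Finset.sum_comm]
            exact Finset.sum_congr rfl fun w _ => Finset.sum_congr rfl fun u _ => by ring
          rw [a2]
          simp only [mul_add, Finset.sum_add_distrib]
          ring
        rw [e1]
        gcongr
        have e2 : (rowSum D v' r - rowSum D v r) / K ≤ ∑ w ∈ Finset.univ.erase v,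
            ((∑ u, (r u : ℝ) * excess D v w (γ w) u) / K) ^ 2 / (4 * γ w) := by
          have hpos : ∀ w ∈ Finset.univ.erase v,
              0 ≤ ((∑ u, (r u : ℝ) * excess D v w (γ w) u) / K) ^ 2 / (4 * γ w) := by
            intro w hw
            have := hγ w (Finset.ne_of_mem_erase hw)
            positivity
          by_cases h : v' = v
          · subst h
            simpa using Finset.sum_nonneg hpos
          · refine le_trans ?_ (Finset.single_le_sum hpos
              (Finset.mem_erase.2 ⟨h, Finset.mem_univ v'⟩))
            refine le_trans (le_max_left _ 0) ((posPart_le_quadratic (hγ v' h)).trans_eq ?_)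
            rw [sum_mul_excess]
            congr 2
            rw [add_div, mul_div_cancel_left₀ _ hKpos.ne']
        refine (add_le_add_left e2 _).trans ?_
        rw [← Finset.sum_add_distrib, gainBound]
        refine Finset.sum_le_sum fun w hw => ?_
        have hw' := hγ w (Finset.ne_of_mem_erase hw)
        rw [← add_div]
        refine div_le_div_of_nonneg_right ?_ (by positivity)
        exact quadratic_step hr _ fun u => excess_sq_le D v w hw'.le u
      calc _ ≤ ∑ v', (N r hr v').toReal * (rowSum D v r + gainBound D v γ r) := by
            gcongr with v' _
            exact hv' v'
        _ = _ := by rw [← Finset.sum_mul, pmf_sum_toReal, one_mul]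

/-! ### From an oblivious optimal strategy to a nonnegative kernel vector. -/

theorem not_forall_mul_le_mul_harmonic {δ C : ℝ} (hδ : 0 < δ) {K : ℕ} (hK : K ≠ 0) :
    ¬ ∀ t : ℕ, t ≠ 0 → t * δ ≤ C * harmonic (t * K) := by
  intro h
  have hlim : Filter.Tendsto (fun t : ℕ => |C| * (1 + Real.log K) * (t : ℝ)⁻¹ +
      |C| * (Real.log t ^ 1 / (1 * t + 0))) Filter.atTop (nhds (|C| * (1 + Real.log K) * 0 +
      |C| * 0)) :=
    (tendsto_inv_atTop_nhds_zero_nat.const_mul _).add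
      (((Real.tendsto_pow_log_div_mul_add_atTop 1 0 1 one_ne_zero).comp
        tendsto_natCast_atTop_atTop).const_mul _)
  have hle : δ ≤ |C| * (1 + Real.log K) * 0 + |C| * 0 := by
    refine ge_of_tendsto hlim ?_
    filter_upwards [Filter.eventually_ne_atTop 0] with t ht
    have htpos : (0 : ℝ) < t := by exact_mod_cast Nat.pos_of_ne_zero ht
    have hh : (0 : ℝ) ≤ harmonic (t * K) := by
      exact_mod_cast (harmonic_pos (Nat.mul_ne_zero ht hK)).le
    have h1 := harmonic_le_one_add_log (t * K)
    rw [Nat.cast_mul, Real.log_mul htpos.ne' (by exact_mod_cast hK)] at h1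
    have h2 : t * δ ≤ |C| * (1 + (Real.log t + Real.log K)) :=
      (h t ht).trans ((mul_le_mul_of_nonneg_right (le_abs_self C) hh).trans
        (mul_le_mul_of_nonneg_left h1 (abs_nonneg C)))
    have h3 : |C| * (1 + Real.log K) * (t : ℝ)⁻¹ + |C| * (Real.log t ^ 1 / (1 * t + 0)) =
        |C| * (1 + (Real.log t + Real.log K)) / t := by
      field_simp
      ring
    rw [h3, le_div_iff₀ htpos]
    linarith
  simp at hle
  linarith

omit [DecidableEq V] in
theorem rowSum_smul (D : Digraph V) (v : V) (t : ℕ) (r : V → ℕ) :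
    rowSum D v (t • r) = t * rowSum D v r := by
  simp [rowSum, Finset.mul_sum, mul_assoc]

/-- Scaling `r` by `t` sets the linear gain of the switching strategy against the logarithmic loss
of the proportional one. -/
theorem sum_mul_payoff_le_of_isOptimal [Nonempty V] {D : Digraph V} {R : ReiStrategy V}
    (hR : R.IsOptimal D) {p : V → ℝ}
    (hp : ∀ r (h : r ≠ 0), (∀ u, r u ≠ 0) → ∀ u, (R.move r h u).toReal = p u) {v : V}
    {r : V → ℕ} (hr : ∀ u, r u ≠ 0) (hv : ∀ w, w ≠ v → rowSum D w r < rowSum D v r) (w : V) :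
    ∑ u, p u * (payoff D w u - payoff D v u : ℝ) ≤ 0 := by
  by_contra! hδ
  have hr0 : r ≠ 0 := fun h => hr v (by simp [h])
  have hK0 := total_ne_zero hr0
  set K := ∑ u, r u with hK
  have hKpos : (0 : ℝ) < K := by exact_mod_cast Nat.pos_of_ne_zero hK0
  -- With this shift the total excess of each `w` is zero at the start, so only the harmonic term of
  -- `gainBound` survives.
  set γ : V → ℝ := fun w => (rowSum D v r - rowSum D w r) / K with hγ
  have hγpos : ∀ w, w ≠ v → 0 < γ w := fun w hw => div_pos (sub_pos.2 (hv w hw)) hKpos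
  refine not_forall_mul_le_mul_harmonic
    (C := ∑ w ∈ Finset.univ.erase v, 2 * (2 + γ w) ^ 2 / (4 * γ w)) hδ hK0 fun t ht => ?_
  have hlow := (rowSum_add_le_expectedScore D R hp v w hδ.le (t • r) t fun u => by
    simpa using Nat.le_mul_of_pos_right t (Nat.pos_of_ne_zero (hr u))).trans
      (le_ciSup (bddAbove_range_expectedScore D R (t • r)) (switchStrategy v w))
  have : Nonempty (NormanStrategy V) := ⟨switchStrategy v v⟩
  have hup : scoreAgainst D (proportionalStrategy V) (t • r) ≤
      rowSum D v (t • r) + gainBound D v γ (t • r) :=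
    ciSup_le fun N => expectedScore_proportionalStrategy_le D N v hγpos _
  have hval : scoreAgainst D R (t • r) ≤ scoreAgainst D (proportionalStrategy V) (t • r) :=
    (hR _).trans_le (value_le_scoreAgainst D _ _)
  have hsum : ∑ u, (t • r) u = t * K := by simp [hK, Finset.mul_sum]
  have hgain : gainBound D v γ (t • r) =
      (∑ w ∈ Finset.univ.erase v, 2 * (2 + γ w) ^ 2 / (4 * γ w)) * harmonic (t * K) := by
    rw [gainBound, Finset.sum_mul]
    refine Finset.sum_congr rfl fun w _ => ?_
    have : ∑ u, ((t • r) u : ℝ) * excess D v w (γ w) u = 0 := by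
      rw [sum_mul_excess, hsum, rowSum_smul, rowSum_smul, hγ]
      push_cast
      field_simp
      ring
    rw [this, hsum]
    ring
  rw [← hgain]
  have hlow' : _ ≤ scoreAgainst D R (t • r) := hlow
  linarith

theorem payoff_swap {V : Type*} {D : Digraph V} (hD : IsTournament D) (u v : V) :
    payoff D u v = -payoff D v u := by
  unfold payoff
  by_cases h : u = v
  · subst h; simp [hD.1]
  · have := hD.2 u v h
    split_ifs <;> simp_all

/-- Every vertex beats some vertex which a given other vertex does not beat. -/
def HasPrivateNeighbors {V : Type*} (D : Digraph V) : Prop :=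
  ∀ v w, w ≠ v → ∃ u, D.Adj v u ∧ ¬ D.Adj w u

/-- Some nonzero nonnegative vector is annihilated by the payoff matrix. -/
def HasNonnegKernel {V : Type*} [Fintype V] (D : Digraph V) : Prop :=
  ∃ p : V → ℝ, p ≠ 0 ∧ (∀ u, 0 ≤ p u) ∧ ∀ v, ∑ u, (payoff D v u : ℝ) * p u = 0

omit [DecidableEq V] in
-- Weight is concentrated on the out-neighbours of `v`, where `v` always scores `1` and each rival
-- falls short at least once.
theorem exists_rowSum_lt [Nonempty V] {D : Digraph V}
    (h : HasPrivateNeighbors D) (v : V) :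
    ∃ r : V → ℕ, (∀ u, r u ≠ 0) ∧ ∀ w, w ≠ v → rowSum D w r < rowSum D v r := by
  classical
  set n := Fintype.card V
  have hn : 0 < n := Fintype.card_pos
  -- The unit background keeps full support and shifts the comparison by at most `2 * n`, less than
  -- the lead of at least `3 * n`.
  refine ⟨fun u => 3 * n * (if D.Adj v u then 1 else 0) + 1, fun u => Nat.succ_ne_zero _,
    fun w hw => ?_⟩
  obtain ⟨u₀, hu₀, hwu₀⟩ := h v w hw
  have hrow : ∀ x, rowSum D x (fun u => 3 * n * (if D.Adj v u then 1 else 0) + 1) =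
      3 * n * (∑ u, if D.Adj v u then (payoff D x u : ℝ) else 0) +
        ∑ u, (payoff D x u : ℝ) := by
    intro x
    rw [rowSum, Finset.mul_sum, ← Finset.sum_add_distrib]
    refine Finset.sum_congr rfl fun u _ => ?_
    split_ifs <;> push_cast <;> ring
  have hb : ∀ x, |∑ u, (payoff D x u : ℝ)| ≤ n := fun x =>
    (Finset.abs_sum_le_sum_abs _ _).trans
      ((Finset.sum_le_sum fun u _ => abs_payoff_le D x u).trans (by simp [n]))
  have hgap : (∑ u, if D.Adj v u then (payoff D w u : ℝ) else 0) + 1 ≤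
      ∑ u, if D.Adj v u then (payoff D v u : ℝ) else 0 := by
    rw [← le_sub_iff_add_le', ← Finset.sum_sub_distrib]
    have hnn : ∀ u ∈ Finset.univ, 0 ≤ (if D.Adj v u then (payoff D v u : ℝ) else 0) -
        (if D.Adj v u then (payoff D w u : ℝ) else 0) := by
      intro u _
      split_ifs with hvu
      · have h1 := (abs_le.1 (abs_payoff_le D w u)).2
        have h2 : payoff D v u = 1 := if_pos hvu
        rw [h2]
        simpa using h1
      · simp
    refine le_trans ?_ (Finset.single_le_sum hnn (Finset.mem_univ u₀))
    have h2 : payoff D v u₀ = 1 := if_pos hu₀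
    have h3 : payoff D w u₀ ≤ 0 := by
      unfold payoff
      rw [if_neg hwu₀]
      split_ifs <;> simp
    have h3' : (payoff D w u₀ : ℝ) ≤ 0 := by exact_mod_cast h3
    rw [if_pos hu₀, if_pos hu₀, h2]
    push_cast
    linarith
  rw [hrow, hrow]
  have h1 := (abs_le.1 (hb w)).2
  have h2 := (abs_le.1 (hb v)).1
  have hnpos : (0 : ℝ) < n := by exact_mod_cast hn
  nlinarith

theorem hasNonnegKernel_of_isObliviousDigraph [Nonempty V] {D : Digraph V} (hD : IsTournament D)
    (hobl : IsObliviousDigraph D) (hpriv : HasPrivateNeighbors D) : HasNonnegKernel D := by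
  obtain ⟨R, hopt, hR⟩ := hobl
  have h1 : (fun _ => 1 : V → ℕ) ≠ 0 := fun h =>
    one_ne_zero (congrFun h (Classical.arbitrary V))
  set p : V → ℝ := fun u => (R.move (fun _ => 1) h1 u).toReal with hpdef
  have hp : ∀ r (h : r ≠ 0), (∀ u, r u ≠ 0) → ∀ u, (R.move r h u).toReal = p u := by
    intro r h hr u
    rw [hR r (fun _ => 1) h h1]
    ext x
    simp [hr x]
  have hle : ∀ v w, ∑ u, p u * (payoff D w u - payoff D v u : ℝ) ≤ 0 := fun v w => by
    obtain ⟨r, hr, hrv⟩ := exists_rowSum_lt hpriv v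
    exact sum_mul_payoff_le_of_isOptimal hopt hp hr hrv w
  have hone : ∑ u, p u = 1 := pmf_sum_toReal _
  have heq : ∀ v w, ∑ u, (payoff D w u : ℝ) * p u = ∑ u, (payoff D v u : ℝ) * p u := by
    have : ∀ v w, ∑ u, (payoff D w u : ℝ) * p u ≤ ∑ u, (payoff D v u : ℝ) * p u := fun v w => by
      rw [← sub_nonpos, ← Finset.sum_sub_distrib]
      exact (Finset.sum_congr rfl fun u _ => by ring).trans_le (hle v w)
    exact fun v w => le_antisymm (this v w) (this w v)
  refine ⟨p, fun h => by simp [h] at hone, fun u => ENNReal.toReal_nonneg, fun v => ?_⟩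
  -- The quadratic form of a skew-symmetric matrix vanishes; since all rows give the same value
  -- against `p`, and `p` has total mass `1`, that value is the form itself.
  have hquad : ∑ w, p w * ∑ u, (payoff D w u : ℝ) * p u = 0 := by
    have hs : ∑ w, p w * ∑ u, (payoff D w u : ℝ) * p u =
        -∑ w, p w * ∑ u, (payoff D w u : ℝ) * p u := by
      conv_lhs => simp only [Finset.mul_sum]
      rw [Finset.sum_comm, ← Finset.sum_neg_distrib]
      refine Finset.sum_congr rfl fun u _ => ?_
      rw [Finset.mul_sum, ← Finset.sum_neg_distrib]
      refine Finset.sum_congr rfl fun w _ => ?_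
      rw [payoff_swap hD w u]
      push_cast
      ring
    linarith
  have : ∑ w, p w * ∑ u, (payoff D w u : ℝ) * p u = ∑ u, (payoff D v u : ℝ) * p u := by
    rw [Finset.sum_congr rfl fun w _ => by rw [heq v w], ← Finset.sum_mul, hone, one_mul]
  rw [← this, hquad]

end Game

/-! ### Tournament matrices of even order are nonsingular -/

/-- Modulo 2 the matrix is `J - I`, and `(J - I) ^ 2 = (n - 2) J + I = I` for even `n`; so the
determinant is odd. -/
theorem det_ne_zero_of_even {V : Type*} [Fintype V] [DecidableEq V] (hV : Even (Fintype.card V))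
    (M : Matrix V V ℤ) (h0 : ∀ i, M i i = 0) (h1 : ∀ i j, i ≠ j → Odd (M i j)) : M.det ≠ 0 := by
  intro hdet
  set B : Matrix V V (ZMod 2) := M.map (Int.castRingHom (ZMod 2)) with hB
  have hBij : ∀ i j, B i j = if i = j then 0 else 1 := by
    intro i j
    by_cases h : i = j
    · subst h; simp [hB, h0]
    · obtain ⟨k, hk⟩ := h1 i j h
      have h2 : (2 : ZMod 2) = 0 := rfl
      simp [hB, h, hk, h2]
  have hBB : B * B = 1 := by
    ext i j
    rw [Matrix.mul_apply]
    have hcard : ((Fintype.card V : ℕ) : ZMod 2) = 0 :=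
      (ZMod.natCast_eq_zero_iff _ _).2 hV.two_dvd
    have h2 : (2 : ZMod 2) = 0 := rfl
    have e : ∀ k, B i k * B k j = 1 - (if i = k then 1 else 0) - (if k = j then 1 else 0) +
        (if i = k then (if i = j then 1 else 0) else 0) := by
      intro k
      rw [hBij, hBij]
      by_cases a : i = k <;> by_cases b : k = j
      · subst a; subst b; simp; exact h2.symm
      · subst a; simp [b]
      · subst b; simp [a]
      · simp [a, b]
    simp_rw [e]
    rw [Finset.sum_add_distrib, Finset.sum_sub_distrib, Finset.sum_sub_distrib]
    simp [hcard, Matrix.one_apply]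
  have hBdet : B.det = 0 := by
    have := RingHom.map_det (Int.castRingHom (ZMod 2)) M
    rw [hdet, map_zero] at this
    exact this.symm
  have := congrArg Matrix.det hBB
  rw [Matrix.det_mul, hBdet, Matrix.det_one, zero_mul] at this
  exact zero_ne_one this

theorem odd_payoff {V : Type*} {D : Digraph V} (hD : IsTournament D) {u v : V} (h : u ≠ v) :
    Odd (payoff D u v) := by
  unfold payoff
  have := hD.2 u v h
  split_ifs
  · exact odd_one
  · exact odd_neg_one
  · simp_all

theorem payoff_self {V : Type*} {D : Digraph V} (hD : IsTournament D) (v : V) :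
    payoff D v v = 0 := by
  simp [payoff, hD.1]

theorem eq_zero_of_even {V : Type*} [Fintype V] (hV : Even (Fintype.card V)) (M : V → V → ℤ)
    (h0 : ∀ i, M i i = 0) (h1 : ∀ i j, i ≠ j → Odd (M i j)) {x : V → ℝ}
    (hx : ∀ v, ∑ u, (M v u : ℝ) * x u = 0) : x = 0 := by
  classical
  have hdet := det_ne_zero_of_even hV (Matrix.of M) h0 h1
  refine Matrix.eq_zero_of_mulVec_eq_zero (M := (Matrix.of M).map (Int.castRingHom ℝ)) ?_ ?_
  · have := RingHom.map_det (Int.castRingHom ℝ) (Matrix.of M)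
    rw [RingHom.mapMatrix_apply] at this
    rw [← this]
    simpa using hdet
  · ext v
    simpa [Matrix.mulVec, dotProduct] using hx v

/-- In odd order, deleting the vanishing coordinate leaves a kernel vector of a tournament matrix of
even order. -/
theorem kernel_eq_zero_of_apply_eq_zero {V : Type*} [Fintype V] {D : Digraph V}
    (hD : IsTournament D) {x : V → ℝ} (hx : ∀ v, ∑ u, (payoff D v u : ℝ) * x u = 0) {i : V}
    (hi : x i = 0) : x = 0 := by
  classical
  by_cases hV : Even (Fintype.card V)
  · exact eq_zero_of_even hV (payoff D) (payoff_self hD) (fun _ _ => odd_payoff hD) hx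
  · have hcard : Even (Fintype.card {j // j ≠ i}) := by
      rw [Fintype.card_subtype_compl, Fintype.card_subtype_eq]
      exact Nat.Odd.sub_odd (Nat.not_even_iff_odd.1 hV) odd_one
    have hy : (fun j : {j // j ≠ i} => x j) = 0 := by
      refine eq_zero_of_even hcard (fun a b => payoff D a b) (fun a => payoff_self hD _)
        (fun a b hab => odd_payoff hD (Subtype.coe_ne_coe.2 hab)) fun v => ?_
      rw [← hx v, Fintype.sum_eq_add_sum_subtype_ne _ i, hi, mul_zero, zero_add]
    ext j
    by_cases hj : j = i
    · rw [hj, hi]; rfl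
    · exact congrFun hy ⟨j, hj⟩

/-- Double counting: if each orbit of a family of involutions of `T` has at most `k` members
with the property `P`, then this bounds the number of all members with this property. -/
theorem card_filter_mul_card_le {α G : Type*} [Fintype G] (T : Finset α) (P : α → Prop)
    [DecidablePred P] (a : G → α → α) (hinv : ∀ g x, a g (a g x) = x)
    (hT : ∀ g, ∀ x ∈ T, a g x ∈ T) {k : ℕ}
    (hk : ∀ x ∈ T, (Finset.univ.filter fun g => P (a g x)).card ≤ k) :
    (T.filter P).card * Fintype.card G ≤ k * T.card := by
  have h1 : ∀ g, (T.filter fun x => P (a g x)).card = (T.filter P).card := fun g => by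
    refine Finset.card_bij' (fun x _ => a g x) (fun x _ => a g x) ?_ ?_ ?_ ?_
    · intro x hx
      rw [Finset.mem_filter] at hx ⊢
      exact ⟨hT g x hx.1, hx.2⟩
    · intro x hx
      rw [Finset.mem_filter] at hx ⊢
      exact ⟨hT g x hx.1, by rw [hinv]; exact hx.2⟩
    · exact fun x _ => hinv g x
    · exact fun x _ => hinv g x
  calc (T.filter P).card * Fintype.card G
      = ∑ g : G, (T.filter fun x => P (a g x)).card := by simp [h1, mul_comm]
    _ = ∑ x ∈ T, (Finset.univ.filter fun g => P (a g x)).card :=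
        Finset.sum_card_bipartiteAbove_eq_sum_card_bipartiteBelow fun g x => P (a g x)
    _ ≤ ∑ _x ∈ T, k := Finset.sum_le_sum hk
    _ = k * T.card := by simp [mul_comm]

/-! ### Families of arc reversals for the double counting. -/

section Reversal

variable {V : Type*}

/-- Reverse the arcs of a tournament between vertices related by `s`. -/
def reverseArcs (s : V → V → Prop) (D : Digraph V) : Digraph V where
  Adj u v := Xor (D.Adj u v) (u ≠ v ∧ s u v)

theorem reverseArcs_adj (s : V → V → Prop) (D : Digraph V) (u v : V) :
    (reverseArcs s D).Adj u v ↔ Xor (D.Adj u v) (u ≠ v ∧ s u v) := Iff.rfl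

theorem reverseArcs_reverseArcs (s : V → V → Prop) (D : Digraph V) :
    reverseArcs s (reverseArcs s D) = D := by
  ext u v
  simp only [reverseArcs_adj, xor_def]
  tauto

theorem isTournament_reverseArcs {s : V → V → Prop} (hs : ∀ u v, s u v ↔ s v u) {D : Digraph V}
    (hD : IsTournament D) : IsTournament (reverseArcs s D) := by
  refine ⟨fun v => by simp [reverseArcs_adj, hD.1], fun u v h => ?_⟩
  have h1 := hD.2 u v h
  have h2 := hs u v
  have h3 := h.symm
  simp only [reverseArcs_adj, xor_def]
  tauto

/-- The sign of a Boolean. -/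
def boolSign (b : Bool) : ℝ := if b then 1 else -1

theorem boolSign_ne_zero (b : Bool) : boolSign b ≠ 0 := by
  cases b <;> simp [boolSign]

/-- Reverse all arcs between the two classes of a bipartition. -/
def switchArcs (ε : V → Bool) : Digraph V → Digraph V :=
  reverseArcs fun u v => ε u ≠ ε v

theorem isTournament_switchArcs {D : Digraph V} (hD : IsTournament D) (ε : V → Bool) :
    IsTournament (switchArcs ε D) :=
  isTournament_reverseArcs (fun _ _ => ne_comm) hD

/-- Switching conjugates the payoff matrix by a diagonal sign matrix, so kernels correspond by sign
changes. -/
theorem payoff_switchArcs {D : Digraph V} (hD : IsTournament D) (ε : V → Bool) (u v : V) :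
    (payoff (switchArcs ε D) u v : ℝ) = boolSign (ε u) * (payoff D u v : ℝ) * boolSign (ε v) := by
  by_cases h : u = v
  · subst h
    rw [payoff_self hD, payoff_self (isTournament_switchArcs hD ε)]
    simp
  · have h1 := hD.2 u v h
    have h3 : v ≠ u := Ne.symm h
    by_cases hA : D.Adj v u
    · have hB : ¬ D.Adj u v := fun h' => h1.1 h' hA
      cases hu : ε u <;> cases hv : ε v <;>
        simp [payoff, switchArcs, reverseArcs_adj, xor_def, boolSign, hu, hv, hA, hB, h, h3]
    · have hB : D.Adj u v := h1.2 hA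
      cases hu : ε u <;> cases hv : ε v <;>
        simp [payoff, switchArcs, reverseArcs_adj, xor_def, boolSign, hu, hv, hA, hB, h, h3]

/-- A nonnegative kernel vector after switching has no zero entry, so `ε` is the sign pattern of a
kernel vector of `D`. The kernel is at most a line, which leaves at most two opposite patterns. -/
theorem card_hasNonnegKernel_switchArcs_le [Fintype V] [Nonempty V] {D : Digraph V}
    (hD : IsTournament D) [DecidablePred fun ε : V → Bool => HasNonnegKernel (switchArcs ε D)]
    [DecidableEq V] :
    (Finset.univ.filter fun ε : V → Bool => HasNonnegKernel (switchArcs ε D)).card ≤ 2 := by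
  obtain ⟨i⟩ := ‹Nonempty V›
  have key : ∀ ε : V → Bool, HasNonnegKernel (switchArcs ε D) → ∃ x : V → ℝ,
      (∀ v, ∑ u, (payoff D v u : ℝ) * x u = 0) ∧ ∀ u, 0 < boolSign (ε u) * x u := by
    rintro ε ⟨p, hp0, hp, hker⟩
    refine ⟨fun u => boolSign (ε u) * p u, fun v => ?_, fun u => ?_⟩
    · have := hker v
      simp only [payoff_switchArcs hD, mul_assoc] at this
      rw [← Finset.mul_sum] at this
      exact (mul_eq_zero.1 this).resolve_left (boolSign_ne_zero _)
    · have hu : p u ≠ 0 := fun h => hp0 (kernel_eq_zero_of_apply_eq_zero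
        (isTournament_switchArcs hD ε) hker h)
      have : 0 < p u := lt_of_le_of_ne (hp u) hu.symm
      cases h : ε u <;> simpa [boolSign, h] using this
  have hinj : Set.InjOn (fun ε : V → Bool => ε i)
      (Finset.univ.filter fun ε : V → Bool => HasNonnegKernel (switchArcs ε D) : Finset _) := by
    intro ε hε ε' hε' hi
    simp only [Finset.coe_filter, Finset.mem_univ, true_and, Set.mem_ofPred_eq] at hε hε' hi
    obtain ⟨x, hx, hxs⟩ := key ε hε
    obtain ⟨y, hy, hys⟩ := key ε' hε'
    -- This combination vanishes at `i`, hence everywhere: `x` and `y` are proportional, and `ε i =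
    -- ε' i` makes the factor positive.
    have hz : (fun u => y i * x u - x i * y u) = 0 := by
      refine kernel_eq_zero_of_apply_eq_zero hD (i := i) (fun v => ?_) (by ring)
      have : ∑ u, (payoff D v u : ℝ) * (y i * x u - x i * y u) =
          y i * ∑ u, (payoff D v u : ℝ) * x u - x i * ∑ u, (payoff D v u : ℝ) * y u := by
        rw [Finset.mul_sum, Finset.mul_sum, ← Finset.sum_sub_distrib]
        exact Finset.sum_congr rfl fun u _ => by ring
      rw [this, hx, hy]
      ring
    ext1 u
    have h1 : y i * x u - x i * y u = 0 := congrFun hz u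
    have h2 := hxs i
    have h3 := hys i
    have h4 := hxs u
    have h5 := hys u
    rw [← hi] at h3
    cases hεi : ε i <;> cases hεu : ε u <;> cases hεu' : ε' u <;>
      simp only [hεi, hεu, hεu', boolSign] at h2 h3 h4 h5 ⊢ <;> simp at h2 h3 h4 h5 ⊢ <;> nlinarith
  simpa using Finset.card_le_card_of_injOn _ (fun ε _ => Finset.mem_univ (ε i)) hinj

/-- Reverse the arcs between `v`, `w` and the other vertices as told by `g`. -/
def reverseAt (v w : V) (g : V → Bool × Bool) : Digraph V → Digraph V :=
  reverseArcs fun a b => (a = v ∧ (g b).1) ∨ (b = v ∧ (g a).1) ∨ (a = w ∧ (g b).2) ∨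
    (b = w ∧ (g a).2)

theorem isTournament_reverseAt {D : Digraph V} (hD : IsTournament D) (v w : V)
    (g : V → Bool × Bool) : IsTournament (reverseAt v w g D) :=
  isTournament_reverseArcs (fun a b => by tauto) hD

/-- For each `u` outside `{v, w}` exactly one of the four values of `g u` makes `v` beat `u` while
`w` does not; avoiding it leaves three. The values at `v` and `w` are left free, whence `16 = 4 ^
2`. -/
theorem card_private_reverseAt_le [Fintype V] [DecidableEq V] {v w : V} (hvw : w ≠ v) (D : Digraph V)
    [DecidablePred fun g : V → Bool × Bool =>
      ∀ u, ¬ ((reverseAt v w g D).Adj v u ∧ ¬ (reverseAt v w g D).Adj w u)] :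
    (Finset.univ.filter fun g : V → Bool × Bool =>
      ∀ u, ¬ ((reverseAt v w g D).Adj v u ∧ ¬ (reverseAt v w g D).Adj w u)).card ≤
      16 * 3 ^ (Fintype.card V - 2) := by
  classical
  have hsub : (Finset.univ.filter fun g : V → Bool × Bool =>
      ∀ u, ¬ ((reverseAt v w g D).Adj v u ∧ ¬ (reverseAt v w g D).Adj w u)) ⊆
      Fintype.piFinset fun u => if u ∈ ({v, w} : Finset V) then Finset.univ else
        Finset.univ.erase (decide (¬ D.Adj v u), decide (D.Adj w u)) := by
    intro g hg
    rw [Finset.mem_filter] at hg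
    rw [Fintype.mem_piFinset]
    intro u
    by_cases hu : u ∈ ({v, w} : Finset V)
    · simp [hu]
    · rw [if_neg hu, Finset.mem_erase]
      refine ⟨fun h => hg.2 u ?_, Finset.mem_univ _⟩
      simp only [Finset.mem_insert, Finset.mem_singleton, not_or] at hu
      have h1 : v ≠ u := Ne.symm hu.1
      have h2 : w ≠ u := Ne.symm hu.2
      have h3 : v ≠ w := hvw.symm
      have hg1 : (g u).1 = decide (¬ D.Adj v u) := by rw [h]
      have hg2 : (g u).2 = decide (D.Adj w u) := by rw [h]
      simp [reverseAt, reverseArcs_adj, xor_def, hg1, hg2, h1, h2, h3, hu, hvw]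
      exact em _
  refine (Finset.card_le_card hsub).trans (le_of_eq ?_)
  have hcard : ∀ u, (if u ∈ ({v, w} : Finset V) then Finset.univ else
      Finset.univ.erase (decide (¬ D.Adj v u), decide (D.Adj w u)) :
      Finset (Bool × Bool)).card = if u ∈ ({v, w} : Finset V) then 4 else 3 := by
    intro u
    split_ifs
    · simp
    · rw [Finset.card_erase_of_mem (Finset.mem_univ _)]
      simp
  have h2 : ({v, w} : Finset V).card = 2 := Finset.card_pair hvw.symm
  rw [Fintype.card_piFinset, Finset.prod_congr rfl fun u _ => hcard u, Finset.prod_ite,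
    Finset.prod_const, Finset.prod_const, Finset.filter_mem_eq_inter, Finset.univ_inter, h2]
  congr 2
  rw [Finset.filter_not, Finset.filter_mem_eq_inter, Finset.univ_inter,
    Finset.card_sdiff_of_subset (Finset.subset_univ _), h2, Finset.card_univ]

end Reversal

/-! ### Union bound and asymptotics. -/

open Classical in
theorem card_oblivious_le {V : Type*} [Fintype V] [DecidableEq V] [Nonempty V] :
    ((Finset.univ.filter fun D : Digraph V => IsTournament D ∧ IsObliviousDigraph D).card : ℝ) ≤
      (2 * (1 / 2) ^ Fintype.card V + 16 / 9 * ((Fintype.card V : ℝ) ^ 2 *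
        (3 / 4) ^ Fintype.card V)) *
        (Finset.univ.filter fun D : Digraph V => IsTournament D).card := by
  set T := Finset.univ.filter fun D : Digraph V => IsTournament D with hT
  set n := Fintype.card V with hn
  have hmem : ∀ D, D ∈ T ↔ IsTournament D := fun D => by simp [hT]
  have hker : ((T.filter HasNonnegKernel).card : ℝ) ≤ 2 * (1 / 2) ^ n * T.card := by
    have h := card_filter_mul_card_le T HasNonnegKernel switchArcs
      (fun _ _ => reverseArcs_reverseArcs _ _)
      (fun g x hx => (hmem _).2 (isTournament_switchArcs ((hmem _).1 hx) g))
      (fun x hx => card_hasNonnegKernel_switchArcs_le ((hmem _).1 hx))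
    rw [Fintype.card_fun, Fintype.card_bool, ← hn] at h
    have h' : ((T.filter HasNonnegKernel).card : ℝ) * 2 ^ n ≤ 2 * T.card := by exact_mod_cast h
    rw [one_div, inv_pow, mul_assoc, mul_left_comm, inv_mul_eq_div, le_div_iff₀ (by positivity)]
    exact h'
  set B : V × V → Finset (Digraph V) := fun q =>
    T.filter fun D => q.2 ≠ q.1 ∧ ∀ u, ¬ (D.Adj q.1 u ∧ ¬ D.Adj q.2 u) with hB
  have hBcard : ∀ q, ((B q).card : ℝ) ≤ 16 / 9 * (3 / 4) ^ n * T.card := by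
    rintro ⟨v, w⟩
    by_cases hvw : w ≠ v
    · have h := card_filter_mul_card_le T
        (fun D : Digraph V => ∀ u, ¬ (D.Adj v u ∧ ¬ D.Adj w u)) (reverseAt v w)
        (fun _ _ => reverseArcs_reverseArcs _ _)
        (fun g x hx => (hmem _).2 (isTournament_reverseAt ((hmem _).1 hx) v w g))
        (fun x _ => card_private_reverseAt_le hvw x)
      have hn2 : 2 ≤ n := by
        rw [hn, ← Finset.card_pair hvw, ← Finset.card_univ]
        exact Finset.card_le_card (Finset.subset_univ _)
      have hBeq : B (v, w) = T.filter fun D => ∀ u, ¬ (D.Adj v u ∧ ¬ D.Adj w u) := by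
        simp [hB, hvw]
      rw [← hBeq, Fintype.card_fun, ← hn] at h
      simp only [Fintype.card_prod, Fintype.card_bool] at h
      have h' : ((B (v, w)).card : ℝ) * 4 ^ n ≤ 16 * 3 ^ (n - 2) * T.card := by exact_mod_cast h
      have h3 : (3 : ℝ) ^ n = 9 * 3 ^ (n - 2) := by
        conv_lhs => rw [← Nat.sub_add_cancel hn2, pow_add]
        ring
      rw [div_pow, h3]
      have h4 : (16 : ℝ) / 9 * (9 * 3 ^ (n - 2) / 4 ^ n) * T.card =
          16 * 3 ^ (n - 2) * T.card / 4 ^ n := by ring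
      rw [h4, le_div_iff₀ (by positivity)]
      exact h'
    · have : B (v, w) = ∅ := by simp [hB, not_not.1 hvw]
      rw [this]
      simp
      positivity
  have hsub : (Finset.univ.filter fun D : Digraph V => IsTournament D ∧ IsObliviousDigraph D) ⊆
      T.filter HasNonnegKernel ∪ Finset.univ.biUnion B := by
    intro D hD
    simp only [Finset.mem_filter, Finset.mem_univ, true_and] at hD
    by_cases hpriv : HasPrivateNeighbors D
    · exact Finset.mem_union_left _ (Finset.mem_filter.2 ⟨(hmem D).2 hD.1,
        hasNonnegKernel_of_isObliviousDigraph hD.1 hD.2 hpriv⟩)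
    · refine Finset.mem_union_right _ (Finset.mem_biUnion.2 ?_)
      simp only [HasPrivateNeighbors, not_forall, not_exists] at hpriv
      obtain ⟨v, w, hvw, h⟩ := hpriv
      exact ⟨(v, w), Finset.mem_univ _, Finset.mem_filter.2 ⟨(hmem D).2 hD.1, hvw, h⟩⟩
  calc _ ≤ (((T.filter HasNonnegKernel).card + ∑ q, (B q).card : ℕ) : ℝ) := by
        exact_mod_cast (Finset.card_le_card hsub).trans
          ((Finset.card_union_le _ _).trans (add_le_add_right Finset.card_biUnion_le _))
    _ ≤ 2 * (1 / 2) ^ n * T.card + ∑ _q : V × V, (16 / 9 : ℝ) * (3 / 4) ^ n * T.card := by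
        push_cast
        exact add_le_add hker (Finset.sum_le_sum fun q _ => hBcard q)
    _ = _ := by
        simp [Fintype.card_prod, ← hn]
        ring

theorem eventually_bound_le :
    ∀ᶠ n : ℕ in Filter.atTop, 2 * (1 / 2 : ℝ) ^ n + 16 / 9 * ((n : ℝ) ^ 2 * (3 / 4) ^ n) ≤
      (9 / 10) ^ n := by
  have h1 := (tendsto_pow_atTop_nhds_zero_of_lt_one (r := (5 / 9 : ℝ)) (by norm_num)
    (by norm_num)).const_mul 2
  have h2 := (tendsto_pow_const_mul_const_pow_of_abs_lt_one 2 (r := (5 / 6 : ℝ))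
    (by rw [abs_of_pos] <;> norm_num)).const_mul (16 / 9)
  have h := h1.add h2
  simp only [mul_zero, add_zero] at h
  filter_upwards [h.eventually (gt_mem_nhds one_pos)] with n hn
  -- Any base strictly between `3 / 4` and `1` would absorb the factor `n ^ 2`; with `9 / 10` the
  -- remaining ratios are `5 / 9` and `5 / 6`.
  have e1 : (1 / 2 : ℝ) ^ n = (5 / 9) ^ n * (9 / 10) ^ n := by rw [← mul_pow]; norm_num
  have e2 : (3 / 4 : ℝ) ^ n = (5 / 6) ^ n * (9 / 10) ^ n := by rw [← mul_pow]; norm_num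
  have hpos : (0 : ℝ) < (9 / 10) ^ n := by positivity
  rw [e1, e2]
  nlinarith

theorem probOblivious_le {n : ℕ} (hn : n ≠ 0) :
    probOblivious n ≤ 2 * (1 / 2 : ℝ) ^ n + 16 / 9 * ((n : ℝ) ^ 2 * (3 / 4) ^ n) := by
  classical
  have : Nonempty (Fin n) := ⟨⟨0, Nat.pos_of_ne_zero hn⟩⟩
  have h := card_oblivious_le (V := Fin n)
  rw [Fintype.card_fin] at h
  unfold probOblivious
  refine div_le_of_le_mul₀ (Nat.cast_nonneg _) (by positivity) ?_
  have e1 : (tournaments n).ncard =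
      (Finset.univ.filter fun D : Digraph (Fin n) => IsTournament D).card := by
    rw [← Set.ncard_coe_finset]; simp [tournaments]
  have e2 : {D ∈ tournaments n | IsObliviousDigraph D}.ncard = (Finset.univ.filter
      fun D : Digraph (Fin n) => IsTournament D ∧ IsObliviousDigraph D).card := by
    rw [← Set.ncard_coe_finset]; simp [tournaments]
  rw [e1, e2]
  convert h

end SemiRestricted

theorem mainTheorem7 :
    ∃ c : ℝ, 0 < c ∧ ∃ n₀ : ℕ, ∀ n : ℕ, n₀ ≤ n →
      SemiRestricted.probOblivious n ≤ Real.exp (-c * (n : ℝ)) := by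
  obtain ⟨n₀, hn₀⟩ := Filter.eventually_atTop.1 SemiRestricted.eventually_bound_le
  refine ⟨Real.log (10 / 9), Real.log_pos (by norm_num), max n₀ 1, fun n hn => ?_⟩
  refine (SemiRestricted.probOblivious_le
    (Nat.one_le_iff_ne_zero.1 ((le_max_right _ _).trans hn))).trans
    ((hn₀ n ((le_max_left _ _).trans hn)).trans_eq ?_)
  rw [← Real.log_inv, mul_comm, Real.exp_nat_mul, Real.exp_log (by norm_num)]
  norm_num
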